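/- Let $L$ be a fixed finite simple graph with at least one edge, and let $\chi(L)$ be its chromatic number. For $n\in\mathbb{N}$ let $M_L(n)$ denote the maximum size of a family $\mathcal{G}$ of simple graphs on the common labeled vertex set $[n]=\{1,\dots,n\}$ such that for any two distinct members $G,G'\in\mathcal{G}$ the graph on $[n]$ whose edge set is the symmetric difference of $E(G)$ and $E(G')$ contains a (not necessarily induced) subgraph isomorphic to $L$. Put $$R_L(n)=\frac{2}{n(n-1)}\log_2 M_L(n).$$ Then the limit $$DC(L):=\lim_{n\to\infty}R_L(n)$$ (the distance capacity of $L$) exists, and $$DC(L)=\frac{1}{\chi(L)-1}.$$ -/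

import Mathlib

open Filter Topology SimpleGraph

noncomputable section

namespace GraphCode

/-- A class of graphs on the labeled vertex sets `Fin n`, `n = 0, 1, 2, …`. -/
abbrev GraphClass : Type := (n : ℕ) → Set (SimpleGraph (Fin n))

/-- The symmetric difference of two graphs on the same vertex set has as edges exactly the pairs
that are edges of exactly one of the two. -/
theorem symmDiff_adj_iff {V : Type*} (G G' : SimpleGraph V) (v w : V) :
    (symmDiff G G').Adj v w ↔ (G.Adj v w ∧ ¬ G'.Adj v w) ∨ (G'.Adj v w ∧ ¬ G.Adj v w) := by
  simp [symmDiff_def]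

/-- A family of graphs on `n` labeled vertices is good for the class `F` if the symmetric
difference of any two distinct members belongs to `F`. -/
def IsGood (F : GraphClass) {n : ℕ} (A : Finset (SimpleGraph (Fin n))) : Prop :=
  ∀ G ∈ A, ∀ G' ∈ A, G ≠ G' → symmDiff G G' ∈ F n

/-- `M_F(n)`: the maximum size of an `F`-good family on `n` labeled vertices. -/
def maxGood (F : GraphClass) (n : ℕ) : ℕ :=
  sSup {m : ℕ | ∃ A : Finset (SimpleGraph (Fin n)), IsGood F A ∧ A.card = m}

/-- The supremum in the definition of `maxGood` is an attained maximum. -/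
theorem isGreatest_maxGood (F : GraphClass) (n : ℕ) :
    IsGreatest {m : ℕ | ∃ A : Finset (SimpleGraph (Fin n)), IsGood F A ∧ A.card = m}
      (maxGood F n) := by
  classical
  have hb : BddAbove {m : ℕ | ∃ A : Finset (SimpleGraph (Fin n)), IsGood F A ∧ A.card = m} := by
    refine ⟨Fintype.card (SimpleGraph (Fin n)), ?_⟩
    rintro m ⟨A, -, rfl⟩
    exact Finset.card_le_univ A
  have hne : {m : ℕ | ∃ A : Finset (SimpleGraph (Fin n)), IsGood F A ∧ A.card = m}.Nonempty :=
    ⟨0, ∅, by simp [IsGood], by simp⟩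
  exact ⟨Nat.sSup_mem hne hb, fun m hm => le_csSup hb hm⟩

/-- The rate `R_F(n) = 2 / (n (n - 1)) * log₂ M_F(n)`. -/
def rate (F : GraphClass) (n : ℕ) : ℝ :=
  2 / ((n : ℝ) * ((n : ℝ) - 1)) * Real.logb 2 (maxGood F n)

/-- The distance capacity (distancity) `DC(F)`, the limit of the rates `R_F(n)` as `n → ∞`. -/
def distanceCapacity (F : GraphClass) : ℝ :=
  limUnder atTop (rate F)

/-- The class of all graphs containing a (not necessarily induced) subgraph isomorphic to `L`. -/
def containing {V : Type*} (L : SimpleGraph V) : GraphClass :=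
  fun _ => {H | L.IsContained H}

end GraphCode

end

/-!
Let `r = χ(L) - 1` and `N = n.choose 2`.

*Upper bound.* The Turán graph `T` with `r` parts, like each of its subgraphs, is `r`-colorable and
so does not contain `L`. Hence the members of a good family differ outside `T`, so that there are
at most `2 ^ (N - e(T))` of them (`maxGood_containing_le`), and `N - e(T)` is asymptotic to `N / r`.

*Lower bound.* A good family of maximum size is maximal, so every graph has an `L`-free symmetric
difference with some member. Therefore `2 ^ N` is at most `maxGood` times the number of `L`-free
graphs (`card_le_maxGood_mul`), and it suffices that this number is at most
`2 ^ ((1 - 1 / r + o(1)) * N)`, which is the theorem of Erdős, Frankl and Rödl.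

For that count, apply Szemerédi's regularity lemma to an `L`-free graph `G`, and keep only the pairs
of distinct clusters that are regular and not sparse. These pairs span a blow-up `H` of a graph on
boundedly many vertices. All but `η * n ^ 2` edges of `G` lie in `H`. Moreover `H` has no clique of
size `r + 1`: a greedy embedding (`exists_embedding_of_lowerRegular`) into the clusters of such a
clique, following a coloring of `L` with `r + 1` colors, would find `L` in `G`
(`exists_blowup_of_free`). There are only `2 ^ O(n)` such `H`; each has at most `e(T)` edges
by Turán's theorem, thus at most `2 ^ e(T)` subgraphs; and there are `2 ^ o(n ^ 2)` choices for the
few edges of `G` outside `H` (`card_sparse_mul_pow_le`).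
-/

namespace GraphCode

/-! ### Greedy embedding into lower-regular pairs -/

/-- The pair `(A, B)` has edge density at least `d` between any two subsets of size at least `c`.
The bound `c` is absolute, not relative to the sizes of `A` and `B`, so that the property passes to
subsets with the same constants. -/
def LowerRegular {α : Type*} (G : SimpleGraph α) [DecidableRel G.Adj] (c d : ℝ)
    (A B : Finset α) : Prop :=
  ∀ X ⊆ A, ∀ Y ⊆ B, c ≤ (X.card : ℝ) → c ≤ (Y.card : ℝ) → d ≤ (G.edgeDensity X Y : ℝ)

theorem LowerRegular.mono {α : Type*} {G : SimpleGraph α} [DecidableRel G.Adj] {c d : ℝ}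
    {A B A' B' : Finset α} (h : LowerRegular G c d A B) (hA : A' ⊆ A) (hB : B' ⊆ B) :
    LowerRegular G c d A' B' :=
  fun X hX Y hY => h X (hX.trans hA) Y (hY.trans hB)

/-- Few vertices of `A` have small degree into `B`: together with `B` they would form a pair of
density less than `d`. -/
theorem LowerRegular.card_small_degree_lt {α : Type*} {G : SimpleGraph α} [DecidableRel G.Adj]
    {c d : ℝ} {A B : Finset α} (h : LowerRegular G c d A B) (hc : 0 < c)
    (hB : c ≤ (B.card : ℝ)) :
    ((A.filter fun x => ((B.filter fun y => G.Adj x y).card : ℝ) < d * B.card).card : ℝ) < c := by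
  by_contra! hX
  set X := A.filter fun x => ((B.filter fun y => G.Adj x y).card : ℝ) < d * B.card with hXdef
  have hd := h X (Finset.filter_subset _ _) B subset_rfl hX hB
  have hXpos : 0 < (X.card : ℝ) := hc.trans_le hX
  have hBpos : 0 < (B.card : ℝ) := hc.trans_le hB
  have hcount : ((G.interedges X B).card : ℝ) =
      ∑ x ∈ X, ((B.filter fun y => G.Adj x y).card : ℝ) := by
    rw [interedges, Rel.interedges, Finset.card_filter, Finset.sum_product]
    push_cast
    exact Finset.sum_congr rfl fun x _ => by rw [Finset.card_filter]; push_cast; rfl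
  have hlt : ((G.interedges X B).card : ℝ) < X.card * (d * B.card) := by
    rw [hcount, ← nsmul_eq_mul, ← Finset.sum_const]
    refine Finset.sum_lt_sum_of_nonempty (Finset.card_pos.1 (by exact_mod_cast hXpos)) ?_
    intro x hx
    exact (Finset.mem_filter.1 hx).2
  rw [edgeDensity_def] at hd
  push_cast at hd
  rw [le_div_iff₀ (by positivity)] at hd
  nlinarith

/-- Greedy embedding: if the candidate sets of adjacent vertices form lower-regular pairs, and all
candidate sets are large compared to `c`, then the part of `L` on `S` embeds with every vertex in its
candidate set. The candidate sets need not be disjoint. The constant `K` depends neither on `c` nor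
on the size of the host graph. -/
theorem exists_embedding_of_lowerRegular {V : Type*} (L : SimpleGraph V)
    {d : ℝ} (hd : 0 < d) (S : Finset V) :
    ∃ K : ℝ, 1 ≤ K ∧ ∀ (c : ℝ), 1 ≤ c → ∀ (α : Type) [Nonempty α]
      (G : SimpleGraph α) [DecidableRel G.Adj] (A : V → Finset α),
      (∀ v ∈ S, ∀ w ∈ S, L.Adj v w → LowerRegular G c d (A v) (A w)) →
      (∀ v ∈ S, K * c ≤ ((A v).card : ℝ)) →
      ∃ f : V → α, (∀ v ∈ S, f v ∈ A v) ∧ Set.InjOn f S ∧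
        ∀ v ∈ S, ∀ w ∈ S, L.Adj v w → G.Adj (f v) (f w) := by
  classical
  induction S using Finset.induction_on with
  | empty => exact ⟨1, le_rfl, fun c _ α _ G _ A _ _ => ⟨fun _ => Classical.arbitrary α, by simp⟩⟩
  | insert v S hv ih =>
    obtain ⟨K, hK1, hK⟩ := ih
    have hKd : 0 ≤ (K + 1) / d := by positivity
    have hS : (0 : ℝ) ≤ S.card := Nat.cast_nonneg _
    refine ⟨(S.card + 1) + (K + 1) / d + (K + 1), by linarith, ?_⟩
    intro c hc α _ G _ A hreg hcard
    have hc0 : 0 < c := by linarith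
    have hlarge : ∀ w ∈ insert v S, c ≤ ((A w).card : ℝ) := fun w hw =>
      le_trans (by nlinarith [mul_nonneg hKd hc0.le, mul_nonneg hS hc0.le]) (hcard w hw)
    set bad : V → Finset α := fun w =>
      (A v).filter fun x => (((A w).filter fun y => G.Adj x y).card : ℝ) < d * (A w).card with hbad
    set B := (S.filter fun w => L.Adj v w).biUnion bad with hB
    have hBcard : (B.card : ℝ) ≤ S.card * c := by
      calc (B.card : ℝ) ≤ ∑ w ∈ S.filter fun w => L.Adj v w, ((bad w).card : ℝ) := by
            exact_mod_cast Finset.card_biUnion_le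
        _ ≤ ∑ w ∈ S.filter fun w => L.Adj v w, c := by
            refine Finset.sum_le_sum fun w hw => ?_
            rw [Finset.mem_filter] at hw
            have hw' := Finset.mem_insert_of_mem (a := w) (b := v) hw.1
            exact ((hreg v (Finset.mem_insert_self v S) w hw' hw.2).card_small_degree_lt hc0
              (hlarge w hw')).le
        _ ≤ S.card * c := by
            rw [Finset.sum_const, nsmul_eq_mul]
            gcongr
            exact Finset.filter_subset _ _
    -- Place `v` at a vertex with large degree into the candidate set of every neighbor of `v`, then
    -- shrink the candidate sets: neighbors of `v` must go to neighbors of `x`, and none to `x`.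
    obtain ⟨x, hxA, hxB⟩ : ∃ x ∈ A v, x ∉ B := by
      apply Finset.exists_mem_notMem_of_card_lt_card
      have h1 := hcard v (Finset.mem_insert_self v S)
      have : (B.card : ℝ) < (A v).card := by nlinarith [mul_nonneg hKd hc0.le]
      exact_mod_cast this
    set A' : V → Finset α := fun w =>
      if L.Adj v w then ((A w).filter fun y => G.Adj x y) else (A w).erase x with hA'
    have hsub : ∀ w, A' w ⊆ A w := by
      intro w
      simp only [hA']
      split_ifs
      · exact Finset.filter_subset _ _
      · exact Finset.erase_subset _ _
    have hxA' : ∀ w, x ∉ A' w := by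
      intro w
      simp only [hA']
      split_ifs <;> simp
    obtain ⟨f, hfA, hfinj, hfadj⟩ := hK c hc α G A'
      (fun u hu w hw huw => (hreg u (Finset.mem_insert_of_mem hu) w
        (Finset.mem_insert_of_mem hw) huw).mono (hsub u) (hsub w))
      (by
        intro w hw
        have h1 := hcard w (Finset.mem_insert_of_mem hw)
        simp only [hA']
        split_ifs with hvw
        · have hxw : x ∉ bad w := fun h =>
            hxB (Finset.mem_biUnion.2 ⟨w, Finset.mem_filter.2 ⟨hw, hvw⟩, h⟩)
          have h2 : d * (A w).card ≤ (((A w).filter fun y => G.Adj x y).card : ℝ) := by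
            by_contra! h
            exact hxw (Finset.mem_filter.2 ⟨hxA, h⟩)
          refine le_trans ?_ h2
          have h3 : (K + 1) / d * c ≤ (A w).card := by
            refine le_trans ?_ h1
            gcongr
            linarith
          calc K * c ≤ d * ((K + 1) / d * c) := by
                rw [← mul_assoc, mul_div_cancel₀ _ hd.ne']
                nlinarith
            _ ≤ d * (A w).card := by gcongr
        · have h4 : ((A w).card : ℝ) - 1 ≤ ((A w).erase x).card := by
            have := Finset.pred_card_le_card_erase (s := A w) (a := x)
            have h5 : (A w).card ≤ ((A w).erase x).card + 1 := by omega
            have h6 : ((A w).card : ℝ) ≤ ((A w).erase x).card + 1 := by exact_mod_cast h5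
            linarith
          nlinarith [mul_nonneg hKd hc0.le, mul_nonneg hS hc0.le])
    have hne : ∀ w ∈ S, w ≠ v := fun w hw h => hv (h ▸ hw)
    have hxf : ∀ w ∈ S, f w ≠ x := fun w hw h => hxA' w (h ▸ hfA w hw)
    have hxadj : ∀ w ∈ S, L.Adj v w → G.Adj x (f w) := by
      intro w hw hvw
      have := hfA w hw
      simp only [hA', if_pos hvw] at this
      exact (Finset.mem_filter.1 this).2
    refine ⟨Function.update f v x, ?_, ?_, ?_⟩
    · intro w hw
      rcases Finset.mem_insert.1 hw with rfl | hw
      · simpa using hxA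
      · rw [Function.update_of_ne (hne w hw)]
        exact hsub w (hfA w hw)
    · intro u hu w hw huw
      rcases Finset.mem_insert.1 (Finset.mem_coe.1 hu) with rfl | hu' <;>
        rcases Finset.mem_insert.1 (Finset.mem_coe.1 hw) with rfl | hw'
      · rfl
      · rw [Function.update_self, Function.update_of_ne (hne w hw')] at huw
        exact absurd huw.symm (hxf w hw')
      · rw [Function.update_self, Function.update_of_ne (hne u hu')] at huw
        exact absurd huw (hxf u hu')
      · rw [Function.update_of_ne (hne u hu'), Function.update_of_ne (hne w hw')] at huw
        exact hfinj hu' hw' huw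
    · intro u hu w hw huw
      rcases Finset.mem_insert.1 hu with rfl | hu' <;>
        rcases Finset.mem_insert.1 hw with rfl | hw'
      · exact absurd huw (L.irrefl)
      · rw [Function.update_self, Function.update_of_ne (hne w hw')]
        exact hxadj w hw' huw
      · rw [Function.update_self, Function.update_of_ne (hne u hu')]
        exact (hxadj u hu' huw.symm).symm
      · rw [Function.update_of_ne (hne u hu'), Function.update_of_ne (hne w hw')]
        exact hfadj u hu' w hw' huw

/-! ### Counting graphs, and the two finite bounds on good families -/

theorem card_le_graph_le {n : ℕ} (H : SimpleGraph (Fin n)) [Fintype H.edgeSet] :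
    Nat.card {A : SimpleGraph (Fin n) // A ≤ H} ≤ 2 ^ H.edgeFinset.card := by
  classical
  rw [← Finset.card_powerset, ← Fintype.card_coe, ← Nat.card_eq_fintype_card]
  refine Nat.card_le_card_of_injective
    (fun A : {A : SimpleGraph (Fin n) // A ≤ H} => (⟨A.1.edgeFinset, by
      rw [Finset.mem_powerset]; exact edgeFinset_mono A.2⟩ : H.edgeFinset.powerset)) ?_
  intro A B hAB
  simp only [Subtype.mk.injEq, edgeFinset_inj] at hAB
  exact Subtype.ext hAB

theorem natCard_simpleGraph (n : ℕ) : Nat.card (SimpleGraph (Fin n)) = 2 ^ n.choose 2 := by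
  classical
  have h : Nat.card (SimpleGraph (Fin n)) =
      Nat.card (⊤ : SimpleGraph (Fin n)).edgeFinset.powerset := by
    refine Nat.card_eq_of_bijective
      (fun A : SimpleGraph (Fin n) => (⟨A.edgeFinset, by
        rw [Finset.mem_powerset]; exact edgeFinset_mono le_top⟩ :
          (⊤ : SimpleGraph (Fin n)).edgeFinset.powerset)) ⟨?_, ?_⟩
    · intro A B hAB
      simpa only [Subtype.mk.injEq, edgeFinset_inj] using hAB
    · rintro ⟨s, hs⟩
      rw [Finset.mem_powerset] at hs
      refine ⟨fromEdgeSet (s : Set (Sym2 (Fin n))), ?_⟩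
      ext e
      simp only [mem_edgeFinset, edgeSet_fromEdgeSet, Set.mem_sdiff, Finset.mem_coe]
      refine ⟨fun h => h.1, fun h => ⟨h, ?_⟩⟩
      have := hs h
      rw [mem_edgeFinset] at this
      exact (⊤ : SimpleGraph (Fin n)).not_isDiag_of_mem_edgeSet this
  rw [h, Nat.card_eq_fintype_card, Fintype.card_coe, Finset.card_powerset,
    card_edgeFinset_top_eq_card_choose_two, Fintype.card_fin]

/-- A bound on the number of graphs with at most `k` edges: the edge sets weighted by `x ^ card`
have total weight `(1 + x) ^ n.choose 2`. With `x` small and `k` a much smaller multiple of `n ^ 2`,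
this makes the number of such graphs `2 ^ o(n ^ 2)`. -/
theorem card_sparse_mul_pow_le (n k : ℕ) {x : ℝ} (hx0 : 0 < x) (hx1 : x ≤ 1) :
    (Nat.card {B : SimpleGraph (Fin n) // B.edgeSet.ncard ≤ k} : ℝ) * x ^ k ≤
      (1 + x) ^ n.choose 2 := by
  classical
  set T := (⊤ : SimpleGraph (Fin n)).edgeFinset with hT
  have hTc : T.card = n.choose 2 := by
    rw [hT, card_edgeFinset_top_eq_card_choose_two, Fintype.card_fin]
  set P := T.powerset.filter fun s => s.card ≤ k with hP
  have h1 : Nat.card {B : SimpleGraph (Fin n) // B.edgeSet.ncard ≤ k} ≤ P.card := by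
    rw [← Fintype.card_coe, ← Nat.card_eq_fintype_card]
    refine Nat.card_le_card_of_injective
      (fun B : {B : SimpleGraph (Fin n) // B.edgeSet.ncard ≤ k} => (⟨B.1.edgeFinset, by
        rw [hP, Finset.mem_filter, Finset.mem_powerset]
        refine ⟨edgeFinset_mono le_top, ?_⟩
        have := B.2
        rwa [Set.ncard_eq_toFinset_card'] at this⟩ : P)) ?_
    intro A B hAB
    simp only [Subtype.mk.injEq, edgeFinset_inj] at hAB
    exact Subtype.ext hAB
  calc (Nat.card {B : SimpleGraph (Fin n) // B.edgeSet.ncard ≤ k} : ℝ) * x ^ k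
      ≤ P.card * x ^ k := by gcongr
    _ = ∑ s ∈ P, x ^ k := by rw [Finset.sum_const, nsmul_eq_mul]
    _ ≤ ∑ s ∈ P, x ^ s.card := Finset.sum_le_sum fun s hs =>
        pow_le_pow_of_le_one hx0.le hx1 (Finset.mem_filter.1 hs).2
    _ ≤ ∑ s ∈ T.powerset, x ^ s.card :=
        Finset.sum_le_sum_of_subset_of_nonneg (Finset.filter_subset _ _) fun s _ _ => by positivity
    _ = (1 + x) ^ n.choose 2 := by
        rw [← hTc, add_comm, ← Finset.sum_pow_mul_eq_add_pow]
        simp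

/-- The Gilbert–Varshamov bound for graph families. -/
theorem card_le_maxGood_mul (F : GraphClass) (n : ℕ) (hbot : ⊥ ∉ F n) :
    2 ^ n.choose 2 ≤ maxGood F n * Nat.card {H : SimpleGraph (Fin n) // H ∉ F n} := by
  classical
  obtain ⟨⟨A, hA, hAc⟩, hmax⟩ := isGreatest_maxGood F n
  -- Otherwise `G` could be added to the family `A` of maximum size.
  have hcover : ∀ G : SimpleGraph (Fin n), ∃ G' ∈ A, symmDiff G G' ∉ F n := by
    intro G
    by_contra! h
    have hGA : G ∉ A := fun hG => hbot (by simpa using h G hG)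
    have hgood : IsGood F (insert G A) := by
      intro G₁ h₁ G₂ h₂ hne
      rcases Finset.mem_insert.1 h₁ with rfl | h₁' <;>
        rcases Finset.mem_insert.1 h₂ with rfl | h₂'
      · exact absurd rfl hne
      · exact h _ h₂'
      · rw [symmDiff_comm]; exact h _ h₁'
      · exact hA _ h₁' _ h₂' hne
    have := hmax ⟨_, hgood, rfl⟩
    rw [Finset.card_insert_of_notMem hGA] at this
    omega
  choose g hgA hgF using hcover
  rw [← natCard_simpleGraph, ← hAc, ← Fintype.card_coe, ← Nat.card_eq_fintype_card,
    ← Nat.card_prod]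
  refine Nat.card_le_card_of_injective
    (fun G : SimpleGraph (Fin n) => ((⟨g G, hgA G⟩, ⟨symmDiff G (g G), hgF G⟩) :
      A × {H : SimpleGraph (Fin n) // H ∉ F n})) ?_
  intro G G' h
  simp only [Prod.mk.injEq, Subtype.mk.injEq] at h
  rw [h.1] at h
  exact symmDiff_left_injective _ h.2

/-- Intersection with the complement of the Turán graph is injective on a good family: two members
with the same intersection have an `r`-colorable symmetric difference. -/
theorem maxGood_containing_le {V : Type*} (L : SimpleGraph V) {r n : ℕ} (hr : 0 < r)
    (hL : ¬ L.Colorable r) :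
    maxGood (containing L) n ≤ 2 ^ (turanGraph n r)ᶜ.edgeFinset.card := by
  classical
  obtain ⟨⟨A, hA, hAc⟩, -⟩ := isGreatest_maxGood (containing L) n
  rw [← hAc, ← Fintype.card_coe, ← Nat.card_eq_fintype_card]
  refine le_trans ?_ (card_le_graph_le _)
  refine Nat.card_le_card_of_injective
    (fun G : A => (⟨G.1 ⊓ (turanGraph n r)ᶜ, inf_le_right⟩ :
      {A : SimpleGraph (Fin n) // A ≤ (turanGraph n r)ᶜ})) ?_
  intro G G' h
  rw [Subtype.mk.injEq] at h
  by_contra hne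
  have hcont := hA G.1 G.2 G'.1 G'.2 (fun h => hne (Subtype.ext h))
  have hle : symmDiff G.1 G'.1 ≤ turanGraph n r := by
    rw [← disjoint_compl_right_iff, disjoint_iff, inf_symmDiff_distrib_right, h, symmDiff_self]
  obtain ⟨f⟩ := hcont
  have : NeZero r := ⟨hr.ne'⟩
  refine hL ⟨Coloring.mk (fun v => Fin.ofNat r (f v)) ?_⟩
  intro v w hvw heq
  have h1 : (turanGraph n r).Adj (f v) (f w) := hle (f.toHom.map_adj hvw)
  rw [turanGraph_adj] at h1
  exact h1 (congrArg Fin.val heq)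

/-! ### Free graphs are nearly contained in clique-free blow-ups -/

/-- The reduced graph of a partition: its vertices are the parts, joined when they are distinct and
form an `ε`-uniform pair of density at least `δ`. It is defined on all finsets, and those that are
not parts are isolated. -/
def clusterGraph {α : Type*} [DecidableEq α] {U : Finset α} (P : Finpartition U)
    (G : SimpleGraph α) [DecidableRel G.Adj] (ε δ : ℝ) : SimpleGraph (Finset α) where
  Adj A B := A ∈ P.parts ∧ B ∈ P.parts ∧ A ≠ B ∧ G.IsUniform ε A B ∧ δ ≤ (G.edgeDensity A B : ℝ)
  symm.symm A B h := ⟨h.2.1, h.1, h.2.2.1.symm, h.2.2.2.1.symm, by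
    rw [edgeDensity_comm]; exact h.2.2.2.2⟩
  loopless.irrefl A h := h.2.2.1 rfl

theorem LowerRegular.of_isUniform {α : Type*} {G : SimpleGraph α} [DecidableRel G.Adj]
    {c ε δ : ℝ} {A B : Finset α} (h : G.IsUniform ε A B) (hδ : δ ≤ (G.edgeDensity A B : ℝ))
    (hA : A.card * ε ≤ c) (hB : B.card * ε ≤ c) : LowerRegular G c (δ - ε) A B := by
  intro X hX Y hY hXc hYc
  have := abs_lt.1 (h hX hY (hA.trans hXc) (hB.trans hYc))
  linarith [this.1]

/-- The edges of `G` outside the blow-up of the cluster graph lie inside a part, in a non-uniform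
pair or in a sparse pair, and there are few of each kind. -/
theorem card_sdiff_comap_clusterGraph_le {n : ℕ} [Nonempty (Fin n)]
    (P : Finpartition (Finset.univ : Finset (Fin n)))
    (G : SimpleGraph (Fin n)) [DecidableRel G.Adj] {ε δ : ℝ} (hε : 0 < ε) (hεδ : ε ≤ δ)
    (hP : P.IsEquipartition) (hPε : P.IsUniform G ε) (hcard : 1 / δ ≤ (P.parts.card : ℝ)) :
    ((G \ (clusterGraph P G ε δ).comap P.part).edgeSet.ncard : ℝ) ≤ 5 * δ * (n : ℝ) ^ 2 := by
  classical
  have hδ : 0 < δ := hε.trans_le hεδ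
  set D := G \ (clusterGraph P G ε δ).comap P.part with hD
  set X := (P.nonUniforms G ε).biUnion fun (U, V) ↦ U ×ˢ V with hX
  set Y := P.parts.biUnion Finset.offDiag with hY
  set Z := (P.sparsePairs G δ).biUnion fun (U, V) ↦ G.interedges U V with hZ
  have hXc : (X.card : ℝ) < 4 * ε * (n : ℝ) ^ 2 := by
    simpa using hP.sum_nonUniforms_lt Finset.univ_nonempty hε hPε
  have hYc : (Y.card : ℝ) ≤ 2 * δ * (n : ℝ) ^ 2 := by
    have h4 : 4 / (4 * δ) ≤ (P.parts.card : ℝ) := by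
      rwa [show 4 / (4 * δ) = 1 / δ by field_simp]
    have := hP.card_biUnion_offDiag_le (by positivity) h4
    simp only [Finset.card_univ, Fintype.card_fin] at this
    linarith
  have hZc : (Z.card : ℝ) ≤ 4 * δ * (n : ℝ) ^ 2 := by
    simpa using hP.card_interedges_sparsePairs_le (G := G) hδ.le
  have hsub : (Finset.univ.filter fun p : Fin n × Fin n => D.Adj p.1 p.2) ⊆ X ∪ Y ∪ Z := by
    rintro ⟨x, y⟩ hxy
    simp only [Finset.mem_filter, Finset.mem_univ, true_and, hD, sdiff_adj, comap_adj] at hxy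
    obtain ⟨hadj, hn⟩ := hxy
    have hx := P.mem_part (Finset.mem_univ x)
    have hy := P.mem_part (Finset.mem_univ y)
    have hxP := P.part_mem.2 (Finset.mem_univ x)
    have hyP := P.part_mem.2 (Finset.mem_univ y)
    by_cases heq : P.part x = P.part y
    · refine Finset.mem_union_left _ (Finset.mem_union_right _ ?_)
      exact Finset.mem_biUnion.2 ⟨P.part x, hxP, Finset.mem_offDiag.2 ⟨hx, heq ▸ hy, hadj.ne⟩⟩
    by_cases hu : G.IsUniform ε (P.part x) (P.part y)
    · have hs : (G.edgeDensity (P.part x) (P.part y) : ℝ) < δ := by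
        by_contra! h
        exact hn ⟨hxP, hyP, heq, hu, h⟩
      refine Finset.mem_union_right _ (Finset.mem_biUnion.2 ⟨(P.part x, P.part y), ?_, ?_⟩)
      · exact (P.mk_mem_sparsePairs G _ _ _).2 ⟨hxP, hyP, heq, hs⟩
      · exact (G.mk_mem_interedges_iff).2 ⟨hx, hy, hadj⟩
    · refine Finset.mem_union_left _ (Finset.mem_union_left _
        (Finset.mem_biUnion.2 ⟨(P.part x, P.part y), ?_, Finset.mem_product.2 ⟨hx, hy⟩⟩))
      exact (P.mk_mem_nonUniforms G).2 ⟨hxP, hyP, heq, hu⟩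
  have htwo : 2 * D.edgeFinset.card ≤ X.card + Y.card + Z.card := by
    -- Each edge of `D` gives two ordered pairs.
    have h2 : 2 * D.edgeFinset.card =
        (Finset.univ.filter fun p : Fin n × Fin n => D.Adj p.1 p.2).card := by
      convert D.two_mul_card_edgeFinset
    rw [h2]
    exact (Finset.card_le_card hsub).trans
      ((Finset.card_union_le _ _).trans (by gcongr; exact Finset.card_union_le _ _))
  have htwo' : 2 * (D.edgeFinset.card : ℝ) ≤ X.card + Y.card + Z.card := by exact_mod_cast htwo
  rw [Set.ncard_eq_toFinset_card']
  change (D.edgeFinset.card : ℝ) ≤ _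
  have : ε * (n : ℝ) ^ 2 ≤ δ * (n : ℝ) ^ 2 := by gcongr
  linarith

/-- An `L`-free graph lies, up to `η * n ^ 2` edges, in a blow-up without `(r + 1)`-cliques of a graph
whose number of vertices `M` is bounded independently of `n`. -/
theorem exists_blowup_of_free {V : Type*} [Finite V] {L : SimpleGraph V} {r : ℕ}
    (hL : L.Colorable (r + 1)) {η : ℝ} (hη : 0 < η) :
    ∃ M n₀ : ℕ, ∀ n ≥ n₀, ∀ G : SimpleGraph (Fin n), L.Free G →
      ∃ (f : Fin n → Fin M) (R : SimpleGraph (Fin M)),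
        (R.comap f).CliqueFree (r + 1) ∧
          ((G \ R.comap f).edgeSet.ncard : ℝ) ≤ η * (n : ℝ) ^ 2 := by
  classical
  have := Fintype.ofFinite V
  obtain ⟨C⟩ := hL
  set δ := η / 5 with hδdef
  have hδ : 0 < δ := by positivity
  obtain ⟨K, hK1, hK⟩ := exists_embedding_of_lowerRegular L (half_pos hδ) Finset.univ
  have hK0 : 0 < K := by linarith
  -- With `ε ≤ δ / 2`, dense uniform pairs have lower density `δ / 2`. With `2 * ε * K ≤ 1`, parts
  -- of size at least `q` suffice for the greedy embedding with `c = 2 * q * ε`.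
  set ε := min (δ / 2) (1 / (2 * K)) with hεdef
  have hε : 0 < ε := lt_min (by positivity) (by positivity)
  have hεδ : ε ≤ δ / 2 := min_le_left _ _
  have hεK : 2 * ε * K ≤ 1 := by
    have : ε ≤ 1 / (2 * K) := min_le_right _ _
    rw [le_div_iff₀ (by positivity)] at this
    linarith
  set l := ⌈1 / δ⌉₊ with hl
  have hl1 : 1 ≤ l := Nat.one_le_ceil_iff.2 (by positivity)
  set M := SzemerediRegularity.bound ε l with hM
  -- Parts of size at least `q₀` give `1 ≤ c`.
  set q₀ := ⌈1 / (2 * ε)⌉₊ with hq₀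
  have hq₀1 : 1 ≤ q₀ := Nat.one_le_ceil_iff.2 (by positivity)
  refine ⟨M, l + M * q₀, fun n hn G hfree => ?_⟩
  have hn0 : 0 < n := by omega
  have : Nonempty (Fin n) := ⟨⟨0, hn0⟩⟩
  obtain ⟨P, hPe, hlP, hPM, hPu⟩ := szemeredi_regularity G hε
    (l := l) (by rw [Fintype.card_fin]; omega)
  have hparts : 0 < P.parts.card := by omega
  -- Relabel the parts by elements of `Fin M`; the blow-up does not change.
  obtain ⟨e⟩ : Nonempty (P.parts ↪ Fin M) :=
    Function.Embedding.nonempty_of_card_le (by simpa using hPM)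
  set p : Fin n → P.parts := fun x => ⟨P.part x, P.part_mem.2 (Finset.mem_univ x)⟩ with hp
  set R₀ : SimpleGraph P.parts := (clusterGraph P G ε δ).comap Subtype.val with hR₀
  have hcomap : (R₀.map e).comap (e ∘ p) = (clusterGraph P G ε δ).comap P.part := by
    have : (R₀.map e).comap (e ∘ p) = ((R₀.map e).comap e).comap p := rfl
    rw [this, comap_map_eq]
    rfl
  refine ⟨e ∘ p, R₀.map e, ?_, ?_⟩
  · rw [hcomap]
    by_contra hclique
    rw [not_cliqueFree_iff_top_isContained] at hclique
    obtain ⟨g⟩ := hclique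
    set q := n / P.parts.card with hq
    have hqq : q₀ ≤ q := by
      rw [hq, Nat.le_div_iff_mul_le hparts]
      calc q₀ * P.parts.card ≤ q₀ * M := by gcongr
        _ ≤ n := by rw [mul_comm]; omega
    have hqr : 1 ≤ 2 * (q : ℝ) * ε := by
      have h1 : 1 / (2 * ε) ≤ (q : ℝ) := (Nat.le_ceil _).trans (by exact_mod_cast hqq)
      rw [div_le_iff₀ (by positivity)] at h1
      linarith
    have hupper : ∀ U ∈ P.parts, (U.card : ℝ) * ε ≤ 2 * (q : ℝ) * ε := by
      intro U hU
      have h1 := hPe.card_part_le_average_add_one hU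
      simp only [Finset.card_univ, Fintype.card_fin] at h1
      have h2 : U.card ≤ 2 * q := by omega
      gcongr
      exact_mod_cast h2
    -- Each vertex `v` of `L` is sent into the cluster of the clique given by the color of `v`.
    obtain ⟨f, -, hinj, hadj⟩ := hK (2 * q * ε) hqr (Fin n) G (fun v => P.part (g (C v)))
      (by
        intro v _ w _ hvw
        have h := g.toHom.map_adj (show (⊤ : SimpleGraph (Fin (r + 1))).Adj (C v) (C w) from
          C.valid hvw)
        obtain ⟨h1, h2, -, h3, h4⟩ := h
        intro X hX Y hY hXc hYc
        exact le_trans (by linarith) (LowerRegular.of_isUniform h3 h4 (hupper _ h1) (hupper _ h2)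
          X hX Y hY hXc hYc))
      (by
        intro v _
        have h1 := hPe.average_le_card_part (P.part_mem.2 (Finset.mem_univ (g (C v))))
        simp only [Finset.card_univ, Fintype.card_fin] at h1
        have h2 : (q : ℝ) ≤ (P.part (g (C v))).card := by exact_mod_cast h1
        refine le_trans ?_ h2
        calc K * (2 * q * ε) = q * (2 * ε * K) := by ring
          _ ≤ q * 1 := by gcongr
          _ = q := mul_one _)
    exact hfree ⟨⟨⟨f, fun h => hadj _ (Finset.mem_univ _) _ (Finset.mem_univ _) h⟩,
      fun a b hab => hinj (by simp) (by simp) hab⟩⟩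
  · rw [hcomap]
    refine (card_sdiff_comap_clusterGraph_le P G hε (by linarith) hPe hPu ?_).trans_eq ?_
    · exact (Nat.le_ceil _).trans (by exact_mod_cast hlP)
    · rw [hδdef]; ring

/-! ### The number of free graphs -/

theorem card_edgeFinset_le_turan {n r : ℕ} {H : SimpleGraph (Fin n)} [Fintype H.edgeSet]
    (hH : H.CliqueFree (r + 1)) : H.edgeFinset.card ≤ (turanGraph n r).edgeFinset.card := by
  classical
  have h := hH.card_edgeFinset_le
  simp only [Fintype.card_fin] at h
  rw [card_edgeFinset_turanGraph]
  convert h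

/-- The Erdős–Frankl–Rödl count: an `L`-free graph is determined by the blow-up `H` that nearly
contains it, its intersection with `H`, and its few edges outside `H`. The factor `C` is the number
of graphs on `Fin M`. -/
theorem exists_card_free_le {V : Type*} [Finite V] {L : SimpleGraph V} {r : ℕ}
    (hL : L.Colorable (r + 1)) {η : ℝ} (hη : 0 < η) :
    ∃ M C n₀ : ℕ, ∀ n ≥ n₀,
      Nat.card {G : SimpleGraph (Fin n) // L.Free G} ≤
        M ^ n * C * (2 ^ (turanGraph n r).edgeFinset.card *
          Nat.card {B : SimpleGraph (Fin n) // B.edgeSet.ncard ≤ ⌊η * (n : ℝ) ^ 2⌋₊}) := by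
  classical
  obtain ⟨M, n₀, h⟩ := exists_blowup_of_free hL hη
  refine ⟨M, Nat.card (SimpleGraph (Fin M)), n₀, fun n hn => ?_⟩
  have h' : ∀ G : {G : SimpleGraph (Fin n) // L.Free G},
      ∃ p : {p : (Fin n → Fin M) × SimpleGraph (Fin M) // (p.2.comap p.1).CliqueFree (r + 1)},
        (G.1 \ p.1.2.comap p.1.1).edgeSet.ncard ≤ ⌊η * (n : ℝ) ^ 2⌋₊ := fun G => by
    obtain ⟨f, R, hfR, hs⟩ := h n hn G.1 G.2
    exact ⟨⟨(f, R), hfR⟩, Nat.le_floor hs⟩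
  choose p hp using h'
  generalize ⌊η * (n : ℝ) ^ 2⌋₊ = k at hp ⊢
  let Sparse := {B : SimpleGraph (Fin n) // B.edgeSet.ncard ≤ k}
  let I := {p : (Fin n → Fin M) × SimpleGraph (Fin M) // (p.2.comap p.1).CliqueFree (r + 1)}
  let g : {G : SimpleGraph (Fin n) // L.Free G} →
      Σ p : I, {A : SimpleGraph (Fin n) // A ≤ p.1.2.comap p.1.1} × Sparse := fun G =>
    ⟨p G, ⟨G.1 ⊓ (p G).1.2.comap (p G).1.1, inf_le_right⟩,
      ⟨G.1 \ (p G).1.2.comap (p G).1.1, hp G⟩⟩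
  have hg : Function.Injective g := by
    have hsup : ∀ G, (g G).2.1.1 ⊔ (g G).2.2.1 = G.1 := fun G => sup_inf_sdiff _ _
    intro G G' hGG
    exact Subtype.ext (by rw [← hsup G, ← hsup G', hGG])
  calc Nat.card {G : SimpleGraph (Fin n) // L.Free G}
      ≤ Nat.card (Σ p : I, {A : SimpleGraph (Fin n) // A ≤ p.1.2.comap p.1.1} × Sparse) :=
        Nat.card_le_card_of_injective g hg
    _ = ∑ p : I, Nat.card {A : SimpleGraph (Fin n) // A ≤ p.1.2.comap p.1.1} * Nat.card Sparse := by
        rw [Nat.card_sigma]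
        exact Finset.sum_congr rfl fun p _ => Nat.card_prod _ _
    _ ≤ ∑ _p : I, 2 ^ (turanGraph n r).edgeFinset.card * Nat.card Sparse := by
        refine Finset.sum_le_sum fun p _ => Nat.mul_le_mul_right _ ?_
        exact (card_le_graph_le _).trans
          (Nat.pow_le_pow_right (by norm_num) (card_edgeFinset_le_turan p.2))
    _ ≤ _ := by
        rw [Finset.sum_const, smul_eq_mul, Finset.card_univ, ← Nat.card_eq_fintype_card]
        refine Nat.mul_le_mul_right _ ?_
        refine (Nat.card_le_card_of_injective _ Subtype.val_injective).trans_eq ?_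
        rw [Nat.card_prod, Nat.card_fun]
        simp

theorem card_edgeFinset_compl_turanGraph (n r : ℕ) :
    (turanGraph n r)ᶜ.edgeFinset.card + (turanGraph n r).edgeFinset.card = n.choose 2 := by
  classical
  have h : (turanGraph n r)ᶜ.edgeFinset =
      (⊤ : SimpleGraph (Fin n)).edgeFinset \ (turanGraph n r).edgeFinset := by
    ext e
    induction e with
    | _ a b => simp [compl_adj]
  rw [h, Finset.card_sdiff_add_card_eq_card (edgeFinset_mono le_top),
    card_edgeFinset_top_eq_card_choose_two, Fintype.card_fin]

theorem card_edgeFinset_turanGraph_bounds {n r : ℕ} (hr : 0 < r) :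
    (1 - 1 / (r : ℝ)) * (n : ℝ) ^ 2 / 2 - ((r : ℝ) ^ 2 + 1) ≤ (turanGraph n r).edgeFinset.card ∧
      ((turanGraph n r).edgeFinset.card : ℝ) ≤ (1 - 1 / (r : ℝ)) * (n : ℝ) ^ 2 / 2 := by
  have hr' : (0 : ℝ) < r := by exact_mod_cast hr
  have hr1 : (1 : ℝ) ≤ r := by exact_mod_cast hr
  constructor
  · have hlt := Nat.lt_div_mul_add (a := (n ^ 2 - (n % r) ^ 2) * (r - 1)) (b := 2 * r) (by omega)
    have hmod : n % r ≤ n := Nat.mod_le _ _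
    have hmod' : n % r ≤ r := (Nat.mod_lt _ hr).le
    set m := n % r with hm
    set t := (n ^ 2 - m ^ 2) * (r - 1) / (2 * r) with ht
    have hte : t ≤ (turanGraph n r).edgeFinset.card := by
      rw [card_edgeFinset_turanGraph]; exact Nat.le_add_right _ _
    have hte' : (t : ℝ) ≤ (turanGraph n r).edgeFinset.card := by exact_mod_cast hte
    have hlt' : ((n : ℝ) ^ 2 - (m : ℝ) ^ 2) * ((r : ℝ) - 1) < t * (2 * r) + 2 * r := by
      have : (((n ^ 2 - m ^ 2) * (r - 1) : ℕ) : ℝ) < ((t * (2 * r) + 2 * r : ℕ) : ℝ) := by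
        exact_mod_cast hlt
      rw [Nat.cast_mul, Nat.cast_sub (Nat.pow_le_pow_left hmod 2), Nat.cast_sub hr] at this
      push_cast at this
      exact this
    have hmr : (m : ℝ) ^ 2 ≤ (r : ℝ) ^ 2 := by
      have : (m : ℝ) ≤ r := by exact_mod_cast hmod'
      gcongr
    refine le_trans ?_ hte'
    have key : (1 - 1 / (r : ℝ)) * (n : ℝ) ^ 2 / 2 = (n : ℝ) ^ 2 * ((r : ℝ) - 1) / (2 * r) := by
      field_simp
    rw [key, sub_le_iff_le_add, div_le_iff₀ (by positivity)]
    nlinarith [mul_le_mul_of_nonneg_right hmr (by linarith : (0 : ℝ) ≤ r - 1), pow_pos hr' 3]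
  · have h := mul_card_edgeFinset_turanGraph_le (n := n) (r := r)
    have h' : (2 * (r : ℝ)) * (turanGraph n r).edgeFinset.card ≤ ((r : ℝ) - 1) * (n : ℝ) ^ 2 := by
      have : ((2 * r * (turanGraph n r).edgeFinset.card : ℕ) : ℝ) ≤
          (((r - 1) * n ^ 2 : ℕ) : ℝ) := by
        exact_mod_cast h
      rw [Nat.cast_mul (r - 1), Nat.cast_sub hr] at this
      push_cast at this
      exact this
    have key : (1 - 1 / (r : ℝ)) * (n : ℝ) ^ 2 / 2 = (n : ℝ) ^ 2 * ((r : ℝ) - 1) / (2 * r) := by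
      field_simp
    rw [key, le_div_iff₀ (by positivity)]
    linarith

/-! ### Asymptotics of the rate -/

theorem tendsto_two_div_mul_quadratic (a b c : ℝ) :
    Tendsto (fun n : ℕ => 2 / ((n : ℝ) * ((n : ℝ) - 1)) * (a * (n : ℝ) ^ 2 + b * n + c)) atTop
      (𝓝 (2 * a)) := by
  have h0 : Tendsto (fun n : ℕ => (n : ℝ)⁻¹) atTop (𝓝 0) := tendsto_inv_atTop_nhds_zero_nat
  have h1 : Tendsto (fun n : ℕ => 2 * (a + b * (n : ℝ)⁻¹ + c * ((n : ℝ)⁻¹ * (n : ℝ)⁻¹)) /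
      (1 - (n : ℝ)⁻¹)) atTop (𝓝 (2 * (a + b * 0 + c * (0 * 0)) / (1 - 0))) :=
    ((((tendsto_const_nhds.add (h0.const_mul b)).add ((h0.mul h0).const_mul c)).const_mul 2).div
      (tendsto_const_nhds.sub h0) (by norm_num))
  have h2 : 2 * (a + b * 0 + c * (0 * 0)) / (1 - 0) = 2 * a := by ring
  rw [h2] at h1
  refine h1.congr' ?_
  filter_upwards [eventually_ge_atTop 2] with n hn
  have hn' : (2 : ℝ) ≤ n := by exact_mod_cast hn
  have h3 : (n : ℝ) - 1 ≠ 0 := by linarith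
  have h4 : (n : ℝ) ≠ 0 := by linarith
  have h5 : 1 - (n : ℝ)⁻¹ ≠ 0 := by
    rw [show 1 - (n : ℝ)⁻¹ = ((n : ℝ) - 1) / n by field_simp]
    exact div_ne_zero h3 h4
  field_simp

theorem logb_maxGood_containing_le {V : Type*} {L : SimpleGraph V} {r : ℕ} (hr : 0 < r)
    (hL : ¬ L.Colorable r) (n : ℕ) :
    Real.logb 2 (maxGood (containing L) n) ≤
      1 / r / 2 * (n : ℝ) ^ 2 + (-1 / 2) * n + ((r : ℝ) ^ 2 + 1) := by
  have hcard : (maxGood (containing L) n : ℝ) ≤ 2 ^ (turanGraph n r)ᶜ.edgeFinset.card := by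
    exact_mod_cast maxGood_containing_le L hr hL
  have hpos : 0 < maxGood (containing L) n :=
    Nat.lt_of_lt_of_le one_pos ((isGreatest_maxGood (containing L) n).2
      ⟨{⊥}, by simp [IsGood], by simp⟩)
  have hlog := Real.logb_le_logb_of_le (b := 2) (by norm_num) (by exact_mod_cast hpos) hcard
  rw [Real.logb_pow, Real.logb_self_eq_one (by norm_num), mul_one] at hlog
  have hsum : ((turanGraph n r)ᶜ.edgeFinset.card : ℝ) + (turanGraph n r).edgeFinset.card =
      n * ((n : ℝ) - 1) / 2 := by
    rw [← Nat.cast_choose_two]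
    exact_mod_cast card_edgeFinset_compl_turanGraph n r
  have := (card_edgeFinset_turanGraph_bounds (n := n) hr).1
  linarith

theorem exists_le_logb_maxGood_containing {V : Type*} [Finite V] {L : SimpleGraph V} {r : ℕ}
    (hr : 0 < r) (hL : L.Colorable (r + 1)) (hbot : L ≠ ⊥) {x η : ℝ} (hx0 : 0 < x) (hx1 : x ≤ 1)
    (hη : 0 < η) :
    ∃ a b : ℝ, ∀ᶠ n : ℕ in atTop,
      (1 / r / 2 - Real.logb 2 (1 + x) / 2 + η * Real.logb 2 x) * (n : ℝ) ^ 2 + a * n + b ≤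
        Real.logb 2 (maxGood (containing L) n) := by
  obtain ⟨M, C, n₀, h⟩ := exists_card_free_le hL hη
  refine ⟨- 1 / 2 + Real.logb 2 (1 + x) / 2 - Real.logb 2 M, - Real.logb 2 C, ?_⟩
  filter_upwards [eventually_ge_atTop n₀] with n hn
  have hsparse := card_sparse_mul_pow_le n ⌊η * (n : ℝ) ^ 2⌋₊ hx0 hx1
  have hk : (⌊η * (n : ℝ) ^ 2⌋₊ : ℝ) ≤ η * (n : ℝ) ^ 2 := Nat.floor_le (by positivity)
  have hfree := h n hn
  have hbotfree : (⊥ : SimpleGraph (Fin n)) ∉ containing L n := by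
    rintro ⟨f⟩
    refine hbot (eq_bot_iff.2 fun v w hvw => ?_)
    exact f.toHom.map_adj hvw
  have hgood : 2 ^ n.choose 2 ≤ maxGood (containing L) n *
      Nat.card {G : SimpleGraph (Fin n) // L.Free G} := card_le_maxGood_mul (containing L) n hbotfree
  generalize ⌊η * (n : ℝ) ^ 2⌋₊ = k at *
  set S := Nat.card {B : SimpleGraph (Fin n) // B.edgeSet.ncard ≤ k} with hS
  set e := (turanGraph n r).edgeFinset.card with he
  set N := n.choose 2 with hN
  set m := maxGood (containing L) n with hm
  have hprod : 2 ^ N ≤ m * (M ^ n * C * (2 ^ e * S)) := hgood.trans (Nat.mul_le_mul_left _ hfree)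
  have hmain : (2 : ℝ) ^ N * x ^ k ≤ m * ((M : ℝ) ^ n * C * (2 ^ e * (1 + x) ^ N)) := by
    have h1 : (2 : ℝ) ^ N ≤ m * ((M : ℝ) ^ n * C * (2 ^ e * S)) := by exact_mod_cast hprod
    calc (2 : ℝ) ^ N * x ^ k ≤ m * ((M : ℝ) ^ n * C * (2 ^ e * S)) * x ^ k := by gcongr
      _ = m * ((M : ℝ) ^ n * C * (2 ^ e * (S * x ^ k))) := by ring
      _ ≤ _ := by gcongr
  have hpos : (0 : ℝ) < m * ((M : ℝ) ^ n * C * (2 ^ e * (1 + x) ^ N)) :=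
    lt_of_lt_of_le (by positivity) hmain
  have hm0 : (m : ℝ) ≠ 0 := left_ne_zero_of_mul hpos.ne'
  have hMC := left_ne_zero_of_mul (right_ne_zero_of_mul hpos.ne')
  have hM0 : (M : ℝ) ^ n ≠ 0 := left_ne_zero_of_mul hMC
  have hC0 : (C : ℝ) ≠ 0 := right_ne_zero_of_mul hMC
  have hlog := Real.logb_le_logb_of_le (b := 2) (by norm_num) (by positivity) hmain
  rw [Real.logb_mul (by positivity) (by positivity), Real.logb_mul hm0 (by positivity),
    Real.logb_mul hMC (by positivity), Real.logb_mul hM0 hC0,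
    Real.logb_mul (by positivity) (by positivity), Real.logb_pow, Real.logb_pow, Real.logb_pow,
    Real.logb_pow, Real.logb_pow, Real.logb_self_eq_one (by norm_num)] at hlog
  have hNr : (N : ℝ) = n * ((n : ℝ) - 1) / 2 := Nat.cast_choose_two ℝ n
  have hee : (e : ℝ) ≤ (1 - 1 / (r : ℝ)) * (n : ℝ) ^ 2 / 2 :=
    (card_edgeFinset_turanGraph_bounds hr).2
  have hlx : Real.logb 2 x ≤ 0 := Real.logb_nonpos (by norm_num) hx0.le hx1
  have hkx : η * (n : ℝ) ^ 2 * Real.logb 2 x ≤ k * Real.logb 2 x :=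
    mul_le_mul_of_nonpos_right hk hlx
  rw [hNr] at hlog
  linarith

theorem tendsto_rate_containing {V : Type*} [Finite V] {L : SimpleGraph V} {r : ℕ} (hr : 0 < r)
    (hL : L.Colorable (r + 1)) (hL' : ¬ L.Colorable r) (hbot : L ≠ ⊥) :
    Tendsto (rate (containing L)) atTop (𝓝 (1 / r)) := by
  have hfac : ∀ n : ℕ, 2 ≤ n → 0 ≤ 2 / ((n : ℝ) * ((n : ℝ) - 1)) := fun n hn => by
    have : (2 : ℝ) ≤ n := by exact_mod_cast hn
    exact div_nonneg (by norm_num) (mul_nonneg (by linarith) (by linarith))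
  rw [tendsto_order]
  constructor
  · intro y hy
    -- First choose `x` so that `logb 2 (1 + x)` is small, then `η` small compared to
    -- `1 / -logb 2 x`; adding `1` to the denominator of `η` covers the case `x = 1`.
    obtain ⟨x, hx0, hx1, hx⟩ : ∃ x : ℝ, 0 < x ∧ x ≤ 1 ∧
        Real.logb 2 (1 + x) < (1 / r - y) / 2 := by
      have hcont : Tendsto (fun x : ℝ => Real.logb 2 (1 + x)) (𝓝[>] 0) (𝓝 0) := by
        have : ContinuousAt (fun x : ℝ => Real.logb 2 (1 + x)) 0 :=
          ContinuousAt.div_const (ContinuousAt.log (by fun_prop) (by norm_num)) _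
        have h0 := this.tendsto.mono_left (nhdsWithin_le_nhds (s := Set.Ioi 0))
        simpa using h0
      have h1 := hcont.eventually (gt_mem_nhds (by linarith : (0 : ℝ) < (1 / r - y) / 2))
      obtain ⟨x, hx, hx'⟩ := (h1.and (Ioc_mem_nhdsGT (zero_lt_one (α := ℝ)))).exists
      exact ⟨x, hx'.1, hx'.2, hx⟩
    have hlx : Real.logb 2 x ≤ 0 := Real.logb_nonpos (by norm_num) hx0.le hx1
    set η := (1 / r - y) / (8 * (1 - Real.logb 2 x)) with hη
    have hη0 : 0 < η := div_pos (by linarith) (by linarith)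
    have hηx : η * (1 - Real.logb 2 x) = (1 / r - y) / 8 := by
      rw [hη]
      have : 1 - Real.logb 2 x ≠ 0 := by linarith
      field_simp
    obtain ⟨a, b, hab⟩ := exists_le_logb_maxGood_containing hr hL hbot hx0 hx1 hη0
    have hlim := tendsto_two_div_mul_quadratic
      (1 / r / 2 - Real.logb 2 (1 + x) / 2 + η * Real.logb 2 x) a b
    have hy' : y < 2 * (1 / r / 2 - Real.logb 2 (1 + x) / 2 + η * Real.logb 2 x) := by
      linarith
    filter_upwards [hab, hlim.eventually (lt_mem_nhds hy'), eventually_ge_atTop 2] with n h1 h2 h3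
    exact h2.trans_le (mul_le_mul_of_nonneg_left h1 (hfac n h3))
  · intro y hy
    have hlim := tendsto_two_div_mul_quadratic (1 / r / 2) (-1 / 2) ((r : ℝ) ^ 2 + 1)
    rw [mul_div_cancel₀ _ two_ne_zero] at hlim
    filter_upwards [hlim.eventually (gt_mem_nhds hy), eventually_ge_atTop 2] with n h2 h3
    exact (mul_le_mul_of_nonneg_left (logb_maxGood_containing_le hr hL' n) (hfac n h3)).trans_lt h2

end GraphCode

theorem mainTheorem1 {V : Type*} [Finite V] (L : SimpleGraph V) (hL : ∃ v w, L.Adj v w) :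
    (∃ c : ℝ, Tendsto (GraphCode.rate (GraphCode.containing L)) atTop (𝓝 c)) ∧
      GraphCode.distanceCapacity (GraphCode.containing L) =
        1 / ((L.chromaticNumber.toNat : ℝ) - 1) := by
  obtain ⟨v, w, hvw⟩ := hL
  have := Fintype.ofFinite V
  have hcol := colorable_chromaticNumber L.colorable_of_fintype
  have hχ : L.chromaticNumber = (L.chromaticNumber.toNat : ℕ∞) :=
    (ENat.natCast_toNat fun htop => by
      simpa [htop] using L.colorable_of_fintype.chromaticNumber_le).symm
  have htwo : 2 ≤ L.chromaticNumber.toNat := by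
    have := two_le_chromaticNumber_of_adj hvw
    rw [hχ] at this
    exact_mod_cast this
  obtain ⟨r, hr⟩ : ∃ r, L.chromaticNumber.toNat = r + 1 := ⟨_, (Nat.sub_add_cancel (by omega)).symm⟩
  rw [hr] at hcol
  have hnot : ¬ L.Colorable r := fun h => by
    have := h.chromaticNumber_le
    rw [hχ, hr] at this
    have : r + 1 ≤ r := by exact_mod_cast this
    omega
  have hlim := GraphCode.tendsto_rate_containing (by omega) hcol hnot
    (fun h => by simp [h] at hvw)
  refine ⟨⟨_, hlim⟩, ?_⟩
  rw [GraphCode.distanceCapacity, hlim.limUnder_eq, hr]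
  push_cast
  rw [add_sub_cancel_right]
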